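/- Let $N\ge 2$. Let $\mathscr M_N^0$ be the class of entire $N\times N$ matrix-valued functions $M$ on $\mathbb C$ such that (a) there is a unitary matrix $J$ with $M(z)\,J\,M(\bar z)^*=J$ for all $z\in\mathbb C$; (b) if $M(z)$ has an eigenvalue of modulus $1$, then $z\in\mathbb R$; (c) the eigenvalues $\tau_1(z),\dots,\tau_N(z)$ of $M(z)$ satisfy $\tfrac12\big(\tau_j(z)+\tau_j(z)^{-1}\big)=\cos z+o(e^{|\operatorname{Im} z|})$ as $|z|\to\infty$, for each $j=1,\dots,N$. Let $M\in\mathscr M_N^0$ and put $$D(\tau,z)=\det\big(M(z)-\tau I_N\big),\qquad \Phi(\nu,z)=\det\Big(\tfrac12\big(M(z)+M(z)^{-1}\big)-\nu I_N\Big).$$ The zeros of $D(1,\cdot)$ are called the periodic eigenvalues and those of $D(-1,\cdot)$ the antiperiodic eigenvalues. Then for every constant $A_0>0$ $$\Phi(\nu,z)-(\cos z-\nu)^N=o\big(e^{N|\operatorname{Im} z|}\big)\qquad\text{as }|z|\to\infty,$$ uniformly in $|\nu|\le A_0$. Moreover, there is an integer $n_0\ge 0$ such that, all roots being counted with multiplicity: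 (i) $\Phi(1,\cdot)$ has exactly $2N(2n_0+1)$ roots in the disc $\{|z|<\pi(2n_0+1)\}$ and, for each integer $n$ with $|n|>n_0$, exactly $2N$ roots in $\{|z-2\pi n|<\frac{\pi}{2}\}$; there are no other roots. Likewise $D(1,\cdot)$ has exactly $N(2n_0+1)$ roots in the first disc, exactly $N$ roots in each of the other discs, and no other roots. (ii) $\Phi(-1,\cdot)$ has exactly $4Nn_0$ roots in the disc $\{|z|<2\pi n_0\}$ and, for each integer $n$ with $|2n+1|>2n_0$, exactly $2N$ roots in $\{|z-\pi(2n+1)|<\frac{\pi}{2}\}$; there are no other roots. Likewise $D(-1,\cdot)$ has exactly $2Nn_0$ roots in the first disc, exactly $N$ roots in each of the other discs, and no other roots. (iii) All periodic and antiperiodic eigenvalues are real. They can be labeled, each repeated according to its multiplicity as a zero of $D(1,\cdot)$, respectively of $D(-1,\cdot)$, as $z_{n,j}$, $n\in\mathbb Z$, $j=1,\dots,N$, where the even $n$ give the periodic and the odd $n$ the antiperiodic eigenvalues, in such a way that $$z_{n,1}\le z_{n,2}\le\dots\le z_{n,N}\le z_{n+2,1}\qquad\text{for all } n\in\mathbb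 Z,$$ and $z_{n,j}=\pi n+o(1)$ as $n\to\pm\infty$, for each $j=1,\dots,N$. -/

import Mathlib

open scoped Matrix ComplexConjugate Topology
open Filter

namespace MonodromyMatrix

/-- The class `𝓜_N`: entire matrix functions `M` with `M(z) J M(z̄)ᴴ = J` for some unitary `J`,
all of whose unimodular eigenvalues occur at real points `z`. -/
structure IsMonodromy {N : ℕ} (M : ℂ → Matrix (Fin N) (Fin N) ℂ) : Prop where
  entire : ∀ i j, Differentiable ℂ (fun z => M z i j)
  symplectic : ∃ J ∈ Matrix.unitaryGroup (Fin N) ℂ, ∀ z, M z * J * (M (conj z))ᴴ = J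
  real_of_norm_eq_one : ∀ z, ∀ τ ∈ spectrum ℂ (M z), ‖τ‖ = 1 → z.im = 0

/-- The class `𝓜_N^0`: every Lyapunov function `Δ = (τ + τ⁻¹) / 2`, with `τ` an eigenvalue of
`M(z)`, equals `cos z + o(exp |Im z|)` as `|z| → ∞`. -/
structure IsMonodromyZero {N : ℕ} (M : ℂ → Matrix (Fin N) (Fin N) ℂ) : Prop
    extends IsMonodromy M where
  asymp : ∀ ε > (0 : ℝ), ∃ R : ℝ, ∀ z : ℂ, R ≤ ‖z‖ → ∀ τ ∈ spectrum ℂ (M z),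
    ‖(τ + τ⁻¹) / 2 - Complex.cos z‖ ≤ ε * Real.exp |z.im|

/-- `D(τ, z) = det (M(z) - τ I)`. -/
noncomputable def D {N : ℕ} (M : ℂ → Matrix (Fin N) (Fin N) ℂ) (τ z : ℂ) : ℂ :=
  (M z - τ • (1 : Matrix (Fin N) (Fin N) ℂ)).det

/-- `L(z) = (M(z) + M(z)⁻¹) / 2`. -/
noncomputable def L {N : ℕ} (M : ℂ → Matrix (Fin N) (Fin N) ℂ) (z : ℂ) :
    Matrix (Fin N) (Fin N) ℂ :=
  (1 / 2 : ℂ) • (M z + (M z)⁻¹)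

/-- `Φ(ν, z) = det (L(z) - ν I)`. -/
noncomputable def Phi {N : ℕ} (M : ℂ → Matrix (Fin N) (Fin N) ℂ) (ν z : ℂ) : ℂ :=
  (L M z - ν • (1 : Matrix (Fin N) (Fin N) ℂ)).det

/-- `f` is analytic on `U`, and has exactly `k` roots in `U`, counted with multiplicity. -/
def HasRootCount (f : ℂ → ℂ) (U : Set ℂ) (k : ℕ) : Prop :=
  AnalyticOnNhd ℂ f U ∧ (∀ w ∈ U, analyticOrderAt f w ≠ ⊤) ∧ {w ∈ U | f w = 0}.Finite ∧
    ∑ᶠ w ∈ U, analyticOrderNatAt f w = k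

/-- `z` lists the periodic (`n` even) and antiperiodic (`n` odd) eigenvalues, each repeated
according to its multiplicity as a zero of `D(1, ·)`, respectively `D(-1, ·)`, with
`z n 0 ≤ … ≤ z n (N - 1) ≤ z (n + 2) 0` for every integer `n`. -/
structure IsEigenvalueLabeling {N : ℕ} (M : ℂ → Matrix (Fin N) (Fin N) ℂ)
    (z : ℤ → Fin N → ℝ) : Prop where
  mono : ∀ n, Monotone (z n)
  le_next : ∀ n i j, z n i ≤ z (n + 2) j
  periodic : ∀ w : ℂ, analyticOrderAt (D M 1) w =
    {p : ℤ × Fin N | Even p.1 ∧ (z p.1 p.2 : ℂ) = w}.encard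
  antiperiodic : ∀ w : ℂ, analyticOrderAt (D M (-1)) w =
    {p : ℤ × Fin N | Odd p.1 ∧ (z p.1 p.2 : ℂ) = w}.encard

end MonodromyMatrix

/-! For `τ τ' = 1` the factorization `Φ((τ + τ') / 2, z) det M(z) = 2⁻ᴺ D(τ, z) D(τ', z)`
(`IsMonodromy.Phi_mul_det`) ties everything together. It shows that each eigenvalue of `L` is a
Lyapunov function `(τ + τ⁻¹) / 2`, hence close to `cos z`. Multiplying the `N` factors gives the
asymptotics of `Φ` (`IsMonodromyZero.Phi_asymp`). With `τ = τ' = ±1` it says that `Φ(±1, ·)` is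
`D(±1, ·)²` up to a nonvanishing factor, so root counts of `D` are half those of `Φ`.

The model `(cos z ∓ 1)ᴺ` has a zero of order `2N` at each node and is at least a constant times
`e^{N|Im z|}` away from the nodes. Rouché's theorem (`HasRootCount.of_norm_sub_lt`) then transfers
its counts to `Φ(±1, ·)` on a large central disc and on small discs about the outer nodes
(`IsMonodromyZero.exists_hasNodalRoots_Phi`).

Roots of `D(±1, ·)` are real because `±1` has modulus one. Sorting them disc by disc, and cutting
the central list into blocks of `N`, yields the labeling (`HasNodalRoots.exists_labels`). Shrinking
the discs yields `z_{n,j} = πn + o(1)`. -/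

namespace MonodromyMatrix

/-! ### Argument principle and Rouché's theorem -/

section RootCount

open Metric

lemma finsum_analyticOrderNatAt_eq_sum {f : ℂ → ℂ} {U : Set ℂ} {Z : Finset ℂ}
    (hZ : {w ∈ U | f w = 0} ⊆ Z) (hZU : (Z : Set ℂ) ⊆ U) :
    ∑ᶠ w ∈ U, analyticOrderNatAt f w = ∑ w ∈ Z, analyticOrderNatAt f w := by
  refine finsum_mem_eq_sum_of_inter_support_eq _ (Set.Subset.antisymm ?_ ?_)
  · rintro w ⟨hwU, hw⟩
    refine ⟨hZ ⟨hwU, ?_⟩, hw⟩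
    apply apply_eq_zero_of_analyticOrderAt_ne_zero
    intro h
    exact hw (by simp [analyticOrderNatAt, h])
  · exact Set.inter_subset_inter_left _ hZU

lemma analyticOrderAt_ne_top_of_entire {f : ℂ → ℂ} (hf : Differentiable ℂ f) {a : ℂ}
    (ha : f a ≠ 0) (w : ℂ) : analyticOrderAt f w ≠ ⊤ := by
  have hA : AnalyticOnNhd ℂ f Set.univ := fun z _ => hf.analyticAt z
  refine hA.analyticOrderAt_ne_top_of_isPreconnected isPreconnected_univ (Set.mem_univ a)
    (Set.mem_univ w) ?_
  rw [(hf.analyticAt a).analyticOrderAt_eq_zero.mpr ha]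
  exact ENat.zero_ne_top

lemma finite_zeros_closedBall {f : ℂ → ℂ} (hf : Differentiable ℂ f) {a : ℂ}
    (ha : f a ≠ 0) (c : ℂ) (R : ℝ) : {w ∈ closedBall c R | f w = 0}.Finite := by
  have hA : AnalyticOnNhd ℂ f Set.univ := fun z _ => hf.analyticAt z
  rcases hA.eqOn_zero_or_eventually_ne_zero_of_preconnected isPreconnected_univ with h | h
  · exact absurd (h (Set.mem_univ a)) ha
  · have h' : {x | f x ≠ 0} ∈ codiscreteWithin (closedBall c R) :=
      Filter.codiscreteWithin_mono (Set.subset_univ _) h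
    refine ((isCompact_closedBall c R).finite_sdiff_of_mem_codiscreteWithin h').subset ?_
    rintro w ⟨hw, h0⟩
    exact ⟨hw, fun h => h h0⟩

lemma exists_hasRootCount {f : ℂ → ℂ} (hf : Differentiable ℂ f) {a : ℂ}
    (ha : f a ≠ 0) (c : ℂ) (R : ℝ) : ∃ k, HasRootCount f (ball c R) k :=
  ⟨_, fun z _ => hf.analyticAt z, fun w _ => analyticOrderAt_ne_top_of_entire hf ha w,
    (finite_zeros_closedBall hf ha c R).subset fun _ hw => ⟨ball_subset_closedBall hw.1, hw.2⟩, rfl⟩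

/-- Argument principle for an entire function on a disc. -/
lemma HasRootCount.circleIntegral_logDeriv {c : ℂ} {R : ℝ} (hR : 0 < R) {k : ℕ} :
    ∀ {f : ℂ → ℂ}, Differentiable ℂ f → (∀ z ∈ sphere c R, f z ≠ 0) →
      HasRootCount f (ball c R) k →
      (∮ z in C(c, R), logDeriv f z) = 2 * Real.pi * Complex.I * k := by
  induction k with
  | zero =>
    intro f hf hs hk
    obtain ⟨-, hfin, hZ, hsum⟩ := hk
    have hne : ∀ z ∈ closedBall c R, f z ≠ 0 := by
      intro z hz h0
      rcases eq_or_ne (dist z c) R with h | h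
      · exact hs z h h0
      · have hzb : z ∈ ball c R := lt_of_le_of_ne hz h
        rw [finsum_analyticOrderNatAt_eq_sum (Z := hZ.toFinset) (by simp) (by
          intro x hx; simp at hx; simpa using hx.1), Finset.sum_eq_zero_iff] at hsum
        have h1 := hsum z (by simpa [h0] using hzb)
        have h2 := (hf.analyticAt z).analyticOrderAt_ne_zero.mpr h0
        rw [← Nat.cast_analyticOrderNatAt (hfin z hzb), h1] at h2
        exact h2 rfl
    have hd : DifferentiableOn ℂ (logDeriv f) (closedBall c R) := by
      intro z hz
      exact ((hf.deriv z).div (hf z) (hne z hz)).differentiableWithinAt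
    rw [DiffContOnCl.circleIntegral_eq_zero hR.le]
    · simp
    · exact ⟨hd.mono ball_subset_closedBall, by
        rw [closure_ball c hR.ne']; exact hd.continuousOn⟩
  | succ k ih =>
    intro f hf hs hk
    obtain ⟨-, hfin, hZ, hsum⟩ := hk
    have hf' := finsum_analyticOrderNatAt_eq_sum (f := f) (U := ball c R) (Z := hZ.toFinset) (by simp) (by
          intro x hx; simp at hx; simpa using hx.1)
    rw [hf'] at hsum
    obtain ⟨w, hw, hw0⟩ := Finset.exists_ne_zero_of_sum_ne_zero (hsum.trans_ne k.succ_ne_zero)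
    have hwb : w ∈ ball c R := by simp at hw; simpa using hw.1
    have hfw : f w = 0 := by simp at hw; exact hw.2
    -- Dividing out one zero `w` leaves an entire function with total order `k` in the disc; the
    -- removed factor contributes `∮ (z - w)⁻¹ = 2πi`.
    set h := dslope f w with hh
    have hhd : Differentiable ℂ h := by
      rw [← differentiableOn_univ]
      exact (Complex.differentiableOn_dslope univ_mem).mpr hf.differentiableOn
    have hfh : f = (fun z => z - w) * h := by
      ext z
      have := sub_smul_dslope f w z
      simpa [hfw] using this.symm
    have hlin : ∀ z, AnalyticAt ℂ (fun z => z - w) z := fun z => by fun_prop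
    have hord : ∀ z, analyticOrderAt f z = analyticOrderAt (fun z => z - w) z + analyticOrderAt h z := by
      intro z
      conv_lhs => rw [hfh]
      exact analyticOrderAt_mul (hlin z) (hhd.analyticAt z)
    have hhfin : ∀ z ∈ ball c R, analyticOrderAt h z ≠ ⊤ := by
      intro z hz ht
      apply hfin z hz
      rw [hord, ht, add_top]
    have hnat : ∀ z ∈ ball c R, analyticOrderNatAt f z =
        (if z = w then 1 else 0) + analyticOrderNatAt h z := by
      intro z hz
      have := hord z
      rw [← Nat.cast_analyticOrderNatAt (hfin z hz), ← Nat.cast_analyticOrderNatAt (hhfin z hz)] at this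
      by_cases hzw : z = w
      · subst hzw
        rw [analyticOrderAt_id_sub_const_self] at this
        simp only [if_true]
        exact_mod_cast this
      · rw [analyticOrderAt_id_sub_const_of_ne hzw] at this
        simp only [hzw, if_false]
        exact_mod_cast this
    have hsub : {z ∈ ball c R | h z = 0} ⊆ {z ∈ ball c R | f z = 0} := by
      rintro z ⟨hz, h0⟩
      exact ⟨hz, by rw [hfh]; simp [h0]⟩
    have hhs : ∀ z ∈ sphere c R, h z ≠ 0 := by
      intro z hz h0
      exact hs z hz (by rw [hfh]; simp [h0])
    have hkh : HasRootCount h (ball c R) k := by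
      refine ⟨fun z _ => hhd.analyticAt z, hhfin, hZ.subset hsub, ?_⟩
      rw [finsum_analyticOrderNatAt_eq_sum (Z := hZ.toFinset) (by simpa using hsub) (by
          intro x hx; simp at hx; simpa using hx.1)]
      rw [Finset.sum_congr rfl (fun z hz => hnat z (by simp at hz; simpa using hz.1)),
        Finset.sum_add_distrib, Finset.sum_ite_eq' , if_pos hw] at hsum
      omega
    have hI := ih hhd hhs hkh
    have hwS : ∀ z ∈ sphere c R, z - w ≠ 0 := by
      intro z hz h0
      rw [sub_eq_zero] at h0
      subst h0
      rw [mem_sphere] at hz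
      rw [mem_ball] at hwb
      linarith
    have hcongr : (∮ z in C(c, R), logDeriv f z) =
        ∮ z in C(c, R), ((z - w)⁻¹ + logDeriv h z) := by
      refine circleIntegral.integral_congr hR.le fun z hz => ?_
      have := logDeriv_mul (f := fun z => z - w) (g := h) z (hwS z hz) (hhs z hz)
        (by fun_prop) (hhd z)
      rw [show f = fun z => (z - w) * h z from hfh]
      simp only [this, logDeriv_apply]
      simp
    rw [hcongr, circleIntegral.integral_add, circleIntegral.integral_sub_inv_of_mem_ball hwb, hI]
    · push_cast; ring
    · rw [circleIntegrable_sub_inv_iff]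
      right
      rw [abs_of_pos hR]
      intro hw'
      exact hwS w hw' (sub_self w)
    · apply ContinuousOn.circleIntegrable hR.le
      intro z hz
      exact ((hhd.deriv z).div (hhd z) (hhs z hz)).continuousAt.continuousWithinAt

/-- Rouché's theorem for entire functions on a disc. -/
lemma HasRootCount.of_norm_sub_lt {f g : ℂ → ℂ} (hf : Differentiable ℂ f)
    (hg : Differentiable ℂ g) {c : ℂ} {R : ℝ} (hR : 0 < R)
    (hfg : ∀ z ∈ sphere c R, ‖f z - g z‖ < ‖g z‖) {k : ℕ} (hk : HasRootCount g (ball c R) k) :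
    HasRootCount f (ball c R) k := by
  have hgs : ∀ z ∈ sphere c R, g z ≠ 0 := fun z hz h0 => by
    have := hfg z hz
    rw [h0, norm_zero] at this
    exact absurd this (not_lt.mpr (norm_nonneg _))
  have hfs : ∀ z ∈ sphere c R, f z ≠ 0 := fun z hz h0 => by
    have := hfg z hz
    rw [h0, zero_sub, norm_neg] at this
    exact lt_irrefl _ this
  obtain ⟨a, ha⟩ : (sphere c R).Nonempty := NormedSpace.sphere_nonempty.mpr hR.le
  obtain ⟨l, hl⟩ := exists_hasRootCount hf (hfs a ha) c R
  have If := hl.circleIntegral_logDeriv hR hf hfs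
  have Ig := hk.circleIntegral_logDeriv hR hg hgs
  have hcont : ∀ {u : ℂ → ℂ}, Differentiable ℂ u → (∀ z ∈ sphere c R, u z ≠ 0) →
      CircleIntegrable (logDeriv u) c R := fun hu hus => by
    apply ContinuousOn.circleIntegrable hR.le
    intro z hz
    exact ((hu.deriv z).div (hu z) (hus z hz)).continuousAt.continuousWithinAt
  -- On the circle `f / g` stays in the unit disc about `1`, inside the slit plane, so the principal
  -- logarithm of `f / g` is a primitive of the integrand.
  have hzero : (∮ z in C(c, R), (logDeriv f z - logDeriv g z)) = 0 := by
    apply circleIntegral.integral_eq_zero_of_hasDerivWithinAt (f := fun z => Complex.log (f z / g z))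
      hR.le
    intro z hz
    have hslit : f z / g z ∈ Complex.slitPlane := by
      have h1 : ‖f z / g z - 1‖ < 1 := by
        rw [div_sub_one (hgs z hz), norm_div, div_lt_one (norm_pos_iff.mpr (hgs z hz))]
        exact hfg z hz
      apply Complex.ball_one_subset_slitPlane
      simpa [dist_eq_norm] using h1
    have hd : HasDerivAt (fun z => f z / g z) (deriv (fun z => f z / g z) z) z :=
      ((hf z).div (hg z) (hgs z hz)).hasDerivAt
    have := (hd.clog hslit).hasDerivWithinAt (s := sphere c R)
    convert this using 1
    exact (logDeriv_div z (hfs z hz) (hgs z hz) (hf z) (hg z)).symm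
  rw [circleIntegral.integral_sub (hcont hf hfs) (hcont hg hgs), If, Ig, ← mul_sub] at hzero
  have : (l : ℂ) = k := by
    have h2 := (mul_eq_zero.mp hzero).resolve_left Complex.two_pi_I_ne_zero
    exact sub_eq_zero.mp h2
  have hlk : l = k := by exact_mod_cast this
  exact hlk ▸ hl

end RootCount

/-! ### Factorization and asymptotics of `Φ` -/

variable {N : ℕ} {M : ℂ → Matrix (Fin N) (Fin N) ℂ}

/-- Replace one factor at a time. The bound is homogeneous in `(B, η)`, so a common factor `e^{|Im
z|}` can be pulled out to the power `s.card`. -/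
lemma norm_multiset_prod_sub_pow_le {s : Multiset ℂ} {b : ℂ} {B η : ℝ} (hb : ‖b‖ ≤ B)
    (hη : 0 ≤ η) (hs : ∀ a ∈ s, ‖a - b‖ ≤ η) :
    ‖s.prod - b ^ s.card‖ ≤ (B + η) ^ s.card - B ^ s.card := by
  have hB : 0 ≤ B := (norm_nonneg b).trans hb
  induction s using Multiset.induction_on with
  | empty => simp
  | cons a s ih =>
    have ih' := ih fun x hx => hs x (Multiset.mem_cons_of_mem hx)
    have ha := hs a (Multiset.mem_cons_self a s)
    have hna : ‖a‖ ≤ B + η := by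
      calc ‖a‖ = ‖b + (a - b)‖ := by ring_nf
        _ ≤ B + η := (norm_add_le _ _).trans (add_le_add hb ha)
    rw [Multiset.prod_cons, Multiset.card_cons]
    calc ‖a * s.prod - b ^ (s.card + 1)‖
        = ‖a * (s.prod - b ^ s.card) + (a - b) * b ^ s.card‖ := by ring_nf
      _ ≤ ‖a‖ * ‖s.prod - b ^ s.card‖ + ‖a - b‖ * ‖b‖ ^ s.card := by
        refine (norm_add_le _ _).trans ?_
        rw [norm_mul, norm_mul, norm_pow]
      _ ≤ (B + η) * ((B + η) ^ s.card - B ^ s.card) + η * B ^ s.card := by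
        gcongr
      _ = _ := by ring

lemma norm_cos_le_exp (z : ℂ) : ‖Complex.cos z‖ ≤ Real.exp |z.im| := by
  rw [Complex.cos, norm_div]
  have h1 : ‖Complex.exp (z * Complex.I)‖ ≤ Real.exp |z.im| := by
    rw [Complex.norm_exp, Real.exp_le_exp]
    simpa using neg_le_abs z.im
  have h2 : ‖Complex.exp (-z * Complex.I)‖ ≤ Real.exp |z.im| := by
    rw [Complex.norm_exp, Real.exp_le_exp]
    simpa using le_abs_self z.im
  have h3 := norm_add_le (Complex.exp (z * Complex.I)) (Complex.exp (-z * Complex.I))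
  simp only [Complex.norm_ofNat]
  linarith

lemma IsMonodromy.det_ne_zero (hM : IsMonodromy M) (z : ℂ) : (M z).det ≠ 0 := by
  obtain ⟨J, hJ, h⟩ := hM.symplectic
  have hJd : J.det ≠ 0 := by
    have := congrArg Matrix.det (Matrix.mem_unitaryGroup_iff.mp hJ)
    rw [Matrix.det_mul, Matrix.det_one] at this
    exact left_ne_zero_of_mul_eq_one this
  intro h0
  have := congrArg Matrix.det (h z)
  rw [Matrix.det_mul, Matrix.det_mul, h0, zero_mul, zero_mul] at this
  exact hJd this.symm

lemma differentiable_det {A : ℂ → Matrix (Fin N) (Fin N) ℂ}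
    (hA : ∀ i j, Differentiable ℂ fun z => A z i j) : Differentiable ℂ fun z => (A z).det := by
  simp only [Matrix.det_apply]
  refine Differentiable.fun_sum fun σ _ => ?_
  refine Differentiable.const_smul (Differentiable.fun_finsetProd fun i _ => hA _ _) _

lemma IsMonodromy.differentiable_det (hM : IsMonodromy M) : Differentiable ℂ fun z => (M z).det :=
  MonodromyMatrix.differentiable_det hM.entire

lemma IsMonodromy.differentiable_D (hM : IsMonodromy M) (τ : ℂ) : Differentiable ℂ (D M τ) := by
  refine MonodromyMatrix.differentiable_det fun i j => ?_
  simp only [Matrix.sub_apply]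
  exact (hM.entire i j).sub_const _

lemma D_eq_zero_iff {τ z : ℂ} : D M τ z = 0 ↔ τ ∈ spectrum ℂ (M z) := by
  rw [spectrum.mem_iff, Matrix.isUnit_iff_isUnit_det, isUnit_iff_ne_zero, not_not,
    ← neg_sub, Matrix.det_neg, Algebra.algebraMap_eq_smul_one, D]
  simp

lemma IsMonodromy.isUnit_det (hM : IsMonodromy M) (z : ℂ) : IsUnit (M z).det :=
  (hM.det_ne_zero z).isUnit

/-- `Φ((τ + τ⁻¹) / 2, z) det M(z) = 2⁻ᴺ D(τ, z) D(τ⁻¹, z)`. -/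
lemma IsMonodromy.Phi_mul_det (hM : IsMonodromy M) {τ τ' : ℂ} (h : τ * τ' = 1) (z : ℂ) :
    Phi M ((τ + τ') / 2) z * (M z).det = (1 / 2) ^ N * (D M τ z * D M τ' z) := by
  have hinv : (M z)⁻¹ * M z = 1 := Matrix.nonsing_inv_mul _ (hM.isUnit_det z)
  have key : (L M z - ((τ + τ') / 2) • (1 : Matrix (Fin N) (Fin N) ℂ)) * M z =
      (1 / 2 : ℂ) • ((M z - τ • (1 : Matrix (Fin N) (Fin N) ℂ)) *
        (M z - τ' • (1 : Matrix (Fin N) (Fin N) ℂ))) := by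
    simp only [L, sub_mul, mul_sub, add_mul, smul_mul_assoc, mul_smul_comm, one_mul, mul_one, hinv]
    have : (1 : Matrix (Fin N) (Fin N) ℂ) = (τ * τ') • 1 := by rw [h, one_smul]
    nth_rewrite 1 [this]
    module
  rw [Phi, ← Matrix.det_mul, key, Matrix.det_smul, Matrix.det_mul, D, D, Fintype.card_fin]

/-- The numbers `l ± √(l² - 1)` are mutually inverse and have mean `l`. -/
lemma exists_add_inv_eq (l : ℂ) : ∃ τ : ℂ, τ ≠ 0 ∧ (τ + τ⁻¹) / 2 = l := by
  obtain ⟨τ, hτ⟩ := IsAlgClosed.exists_eq_mul_self (l ^ 2 - 1)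
  have hmul : (l + τ) * (l - τ) = 1 := by linear_combination hτ
  have h0 : l + τ ≠ 0 := left_ne_zero_of_mul_eq_one hmul
  refine ⟨l + τ, h0, ?_⟩
  rw [← eq_inv_of_mul_eq_one_right hmul]
  ring

/-- By the factorization, one of `τ`, `τ⁻¹` is an eigenvalue of `M(z)`, and the Lyapunov function is
the same for both. -/
lemma IsMonodromy.exists_of_mem_spectrum_L (hM : IsMonodromy M) {z l : ℂ}
    (hl : Phi M l z = 0) : ∃ τ ∈ spectrum ℂ (M z), (τ + τ⁻¹) / 2 = l := by
  obtain ⟨τ, h0, rfl⟩ := exists_add_inv_eq l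
  have := hM.Phi_mul_det (mul_inv_cancel₀ h0) z
  rw [hl, zero_mul, eq_comm, mul_eq_zero] at this
  rcases mul_eq_zero.mp (this.resolve_left (pow_ne_zero _ (by norm_num))) with h | h
  · exact ⟨τ, D_eq_zero_iff.mp h, rfl⟩
  · exact ⟨τ⁻¹, D_eq_zero_iff.mp h, by rw [inv_inv, add_comm]⟩

lemma Phi_eq_prod_roots (ν z : ℂ) :
    Phi M ν z = ((L M z).charpoly.roots.map fun l => l - ν).prod := by
  have h := (IsAlgClosed.splits (L M z).charpoly).eq_prod_roots_of_monic (Matrix.charpoly_monic _)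
  have h2 := Matrix.eval_charpoly (L M z) ν
  rw [h, Polynomial.eval_multiset_prod, Multiset.map_map] at h2
  have hcard : (L M z).charpoly.roots.card = N := by
    rw [← (IsAlgClosed.splits (L M z).charpoly).natDegree_eq_card_roots, Matrix.charpoly_natDegree_eq_dim,
      Fintype.card_fin]
  have h3 : ((L M z).charpoly.roots.map fun l => l - ν) =
      (L M z).charpoly.roots.map (fun l => (-1) * (ν - l)) := by
    congr 1; ext l; ring
  rw [h3, Multiset.prod_map_mul, Multiset.map_const', Multiset.prod_replicate, hcard]
  simp only [Function.comp_def, Polynomial.eval_sub, Polynomial.eval_X, Polynomial.eval_C] at h2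
  rw [h2, Phi, ← neg_sub, Matrix.det_neg, Fintype.card_fin, Matrix.scalar_apply,
    ← Matrix.smul_one_eq_diagonal]

lemma IsMonodromyZero.Phi_asymp (hM : IsMonodromyZero M) {A ε : ℝ} (hA : 0 < A) (hε : 0 < ε) :
    ∃ R : ℝ, ∀ z ν : ℂ, R ≤ ‖z‖ → ‖ν‖ ≤ A →
      ‖Phi M ν z - (Complex.cos z - ν) ^ N‖ ≤ ε * Real.exp (N * |z.im|) := by
  obtain ⟨δ, hδ, hδε⟩ : ∃ δ > (0 : ℝ), (1 + A + δ) ^ N - (1 + A) ^ N ≤ ε := by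
    have hc : Tendsto (fun δ : ℝ => (1 + A + δ) ^ N - (1 + A) ^ N) (𝓝[>] 0) (𝓝 0) := by
      have : Continuous fun δ : ℝ => (1 + A + δ) ^ N - (1 + A) ^ N := by fun_prop
      have := this.tendsto 0
      simp only [add_zero, sub_self] at this
      exact this.mono_left nhdsWithin_le_nhds
    have h1 := hc.eventually (gt_mem_nhds hε)
    obtain ⟨δ, h2, h3⟩ := (h1.and self_mem_nhdsWithin).exists
    exact ⟨δ, h3, h2.le⟩
  obtain ⟨R, hR⟩ := hM.asymp δ hδ
  refine ⟨R, fun z ν hz hν => ?_⟩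
  set E := Real.exp |z.im| with hE
  have hE1 : 1 ≤ E := Real.one_le_exp (abs_nonneg _)
  have hcard : ((L M z).charpoly.roots.map fun l => l - ν).card = N := by
    rw [Multiset.card_map, ← (IsAlgClosed.splits (L M z).charpoly).natDegree_eq_card_roots,
      Matrix.charpoly_natDegree_eq_dim, Fintype.card_fin]
  -- Since `E ≥ 1`, the constant `A` is absorbed, making the bound proportional to `E` and uniform
  -- in `ν`.
  have hb : ‖Complex.cos z - ν‖ ≤ (1 + A) * E := by
    calc ‖Complex.cos z - ν‖ ≤ E + A := (norm_sub_le _ _).trans (add_le_add (norm_cos_le_exp z) hν)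
      _ ≤ (1 + A) * E := by nlinarith
  have := norm_multiset_prod_sub_pow_le (s := (L M z).charpoly.roots.map fun l => l - ν) hb
    (by positivity : 0 ≤ δ * E) (by
      intro a ha
      obtain ⟨l, hl, rfl⟩ := Multiset.mem_map.mp ha
      have hl0 : Phi M l z = 0 := by
        rw [Phi_eq_prod_roots, Multiset.prod_eq_zero_iff, Multiset.mem_map]
        exact ⟨l, hl, sub_self l⟩
      obtain ⟨τ, hτ, rfl⟩ := hM.exists_of_mem_spectrum_L hl0
      simpa using hR z hz τ hτ)
  rw [hcard, ← Phi_eq_prod_roots] at this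
  refine this.trans ?_
  rw [Real.exp_nat_mul, ← hE, ← add_mul, mul_pow, mul_pow, ← sub_mul]
  gcongr

/-- The factorization writes `Φ(ν, ·)` as a quotient of entire functions whose denominator `det M`
never vanishes. -/
lemma IsMonodromy.differentiable_Phi (hM : IsMonodromy M) (ν : ℂ) :
    Differentiable ℂ (Phi M ν) := by
  obtain ⟨τ, h0, rfl⟩ := exists_add_inv_eq ν
  have : Phi M ((τ + τ⁻¹) / 2) =
      fun z => (1 / 2) ^ N * (D M τ z * D M τ⁻¹ z) / (M z).det := by
    ext z
    rw [eq_div_iff (hM.det_ne_zero z), hM.Phi_mul_det (mul_inv_cancel₀ h0)]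
  rw [this]
  exact (((hM.differentiable_D τ).mul (hM.differentiable_D τ⁻¹)).const_mul _).div
    hM.differentiable_det hM.det_ne_zero

/-! ### Passing between `Φ(±1, ·)` and `D(±1, ·)` -/

section PeriodicEigenvalues

variable {σ : ℂ}

lemma IsMonodromy.im_eq_zero_of_D_eq_zero (hM : IsMonodromy M) (hσ : ‖σ‖ = 1) {z : ℂ}
    (h : D M σ z = 0) : z.im = 0 :=
  hM.real_of_norm_eq_one z σ (D_eq_zero_iff.mp h) hσ

lemma IsMonodromy.analyticOrderAt_Phi (hM : IsMonodromy M) (hσ : σ * σ = 1) (w : ℂ) :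
    analyticOrderAt (Phi M σ) w = 2 * analyticOrderAt (D M σ) w := by
  have h2 : (σ + σ) / 2 = σ := by ring
  have hfun : Phi M σ * (fun z => (M z).det) = (fun _ => (1 / 2) ^ N) * (D M σ) ^ 2 := by
    ext z
    have := hM.Phi_mul_det hσ z
    rw [h2] at this
    simpa [sq] using this
  have h := congrArg (analyticOrderAt · w) hfun
  rw [analyticOrderAt_mul ((hM.differentiable_Phi σ).analyticAt w)
      (hM.differentiable_det.analyticAt w),
    analyticOrderAt_mul analyticAt_const (((hM.differentiable_D σ).analyticAt w).pow 2),
    analyticOrderAt_pow ((hM.differentiable_D σ).analyticAt w),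
    (hM.differentiable_det.analyticAt w).analyticOrderAt_eq_zero.mpr (hM.det_ne_zero w),
    analyticAt_const.analyticOrderAt_eq_zero.mpr (pow_ne_zero _ (by norm_num))] at h
  simpa using h

lemma IsMonodromy.Phi_eq_zero_iff (hM : IsMonodromy M) (hσ : σ * σ = 1) {w : ℂ} :
    Phi M σ w = 0 ↔ D M σ w = 0 := by
  have h2 : (σ + σ) / 2 = σ := by ring
  have := hM.Phi_mul_det hσ w
  rw [h2] at this
  constructor <;> intro h
  · simpa [h] using this.symm
  · simpa [h, hM.det_ne_zero w] using this

lemma IsMonodromy.hasRootCount_D (hM : IsMonodromy M) (hσ : σ * σ = 1) {U : Set ℂ} {k : ℕ}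
    (h : HasRootCount (Phi M σ) U (2 * k)) : HasRootCount (D M σ) U k := by
  obtain ⟨-, hfin, hZ, hsum⟩ := h
  have hfin' : ∀ w ∈ U, analyticOrderAt (D M σ) w ≠ ⊤ := by
    intro w hw ht
    apply hfin w hw
    rw [hM.analyticOrderAt_Phi hσ, ht]
    simp
  refine ⟨fun z _ => (hM.differentiable_D σ).analyticAt z, hfin', ?_, ?_⟩
  · simpa only [hM.Phi_eq_zero_iff hσ] using hZ
  · have hZU : (hZ.toFinset : Set ℂ) ⊆ U := by
      intro x hx; simp only [Set.Finite.coe_toFinset] at hx; exact hx.1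
    rw [finsum_analyticOrderNatAt_eq_sum (Z := hZ.toFinset) (by simp) hZU] at hsum
    rw [finsum_analyticOrderNatAt_eq_sum (Z := hZ.toFinset)
      (by simp only [← hM.Phi_eq_zero_iff hσ]; simp) hZU]
    have hnat : ∀ w ∈ hZ.toFinset, analyticOrderNatAt (Phi M σ) w =
        2 * analyticOrderNatAt (D M σ) w := by
      intro w hw
      have := hM.analyticOrderAt_Phi hσ w
      rw [← Nat.cast_analyticOrderNatAt (hfin w (hZU hw)),
        ← Nat.cast_analyticOrderNatAt (hfin' w (hZU hw))] at this
      exact_mod_cast this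
    rw [Finset.sum_congr rfl hnat, ← Finset.mul_sum] at hsum
    omega

end PeriodicEigenvalues

/-! ### The model function `cos z ∓ 1` and its nodes -/

/-- The `k`-th zero of `cos z - cos (π p)`. -/
noncomputable def node (p k : ℤ) : ℂ := Real.pi * (2 * k + p : ℤ)

/-- The number `cos (π p) = ± 1`. -/
noncomputable def nodeSign (p : ℤ) : ℂ := Complex.exp (Real.pi * p * Complex.I)

lemma nodeSign_mul_self (p : ℤ) : nodeSign p * nodeSign p = 1 := by
  rw [nodeSign, ← Complex.exp_add, Complex.exp_eq_one_iff]
  exact ⟨p, by ring⟩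

lemma norm_nodeSign (p : ℤ) : ‖nodeSign p‖ = 1 := by
  rw [nodeSign, Complex.norm_exp]
  simp

lemma nodeSign_zero : nodeSign 0 = 1 := by simp [nodeSign]

lemma nodeSign_one : nodeSign 1 = -1 := by simp [nodeSign, Complex.exp_pi_mul_I]

lemma neg_node (p k : ℤ) : -node p k = node p (-k - p) := by
  simp only [node]; push_cast; ring

lemma exp_eq_nodeSign_iff {p : ℤ} {z : ℂ} :
    Complex.exp (z * Complex.I) = nodeSign p ↔ ∃ k, z = node p k := by
  rw [nodeSign, Complex.exp_eq_exp_iff_exists_int]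
  refine exists_congr fun k => ?_
  rw [show (Real.pi * p * Complex.I + k * (2 * Real.pi * Complex.I) : ℂ) = node p k * Complex.I by
    rw [node]; push_cast; ring]
  exact mul_left_inj' Complex.I_ne_zero

/-- If `x = e^u - 1` has norm below `1/2`, then `‖log (1 + x)‖ ≤ (3/2) ‖x‖`. As `u` differs from
this logarithm by a multiple of `2πi`, `z` lies that close to a node; this gives both constants in
the minimum. -/
lemma le_norm_exp_sub_nodeSign {p : ℤ} {δ : ℝ} {z : ℂ} (hz : ∀ k, δ ≤ ‖z - node p k‖) :
    min (1 / 2) (2 / 3 * δ) ≤ ‖Complex.exp (z * Complex.I) - nodeSign p‖ := by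
  by_contra! hlt
  obtain ⟨h1, h2⟩ := lt_min_iff.mp hlt
  set u := (z - Real.pi * p) * Complex.I with hu
  have hmul : Complex.exp (z * Complex.I) - nodeSign p = nodeSign p * (Complex.exp u - 1) := by
    rw [mul_sub, mul_one, nodeSign, ← Complex.exp_add]
    congr 2; rw [hu]; ring
  rw [hmul, norm_mul, norm_nodeSign, one_mul] at h1 h2
  have hlog := Complex.norm_log_one_add_half_le_self h1.le
  set v := Complex.log (1 + (Complex.exp u - 1)) with hv
  have hexp : Complex.exp u = Complex.exp v := by
    rw [hv, Complex.exp_log] <;> rw [add_sub_cancel]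
    exact Complex.exp_ne_zero u
  obtain ⟨n, hn⟩ := Complex.exp_eq_exp_iff_exists_int.mp hexp
  have hzn : z - node p n = -Complex.I * v := by
    have : v = u - n * (2 * Real.pi * Complex.I) := by rw [hn]; ring
    rw [this, hu, node]
    push_cast
    linear_combination (z - Real.pi * p - 2 * Real.pi * n) * Complex.I_sq
  have := hz n
  rw [hzn, norm_mul, norm_neg, Complex.norm_I, one_mul] at this
  linarith

/-- Because the sign squares to `1`, the difference is a perfect square up to an exponential. This
explains the double zeros and reduces lower bounds to those for `e^{iz}`. -/
lemma cos_sub_nodeSign (p : ℤ) (z : ℂ) : Complex.cos z - nodeSign p =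
    Complex.exp (-z * Complex.I) / 2 * (Complex.exp (z * Complex.I) - nodeSign p) ^ 2 := by
  have h1 : Complex.exp (-z * Complex.I) * Complex.exp (z * Complex.I) = 1 := by
    rw [← Complex.exp_add]; simp
  rw [Complex.cos]
  linear_combination (-(Complex.exp (z * Complex.I)) / 2 + nodeSign p) * h1
    - Complex.exp (-z * Complex.I) / 2 * nodeSign_mul_self p

lemma le_norm_cos_sub_nodeSign {p : ℤ} {δ : ℝ} (hδ : 0 ≤ δ) {z : ℂ}
    (hz : ∀ k, δ ≤ ‖z - node p k‖) :
    min (1 / 2) (2 / 3 * δ) ^ 2 / 2 * Real.exp |z.im| ≤ ‖Complex.cos z - nodeSign p‖ := by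
  -- In the upper half-plane the prefactor has modulus `e^{Im w} / 2`. The lower half-plane follows
  -- since cosine is even and the nodes are symmetric under negation.
  have key : ∀ w : ℂ, 0 ≤ w.im → (∀ k, δ ≤ ‖w - node p k‖) →
      min (1 / 2) (2 / 3 * δ) ^ 2 / 2 * Real.exp |w.im| ≤ ‖Complex.cos w - nodeSign p‖ := by
    intro w hw0 hw
    have h := le_norm_exp_sub_nodeSign hw
    rw [cos_sub_nodeSign, norm_mul, norm_div, norm_pow, Complex.norm_exp, Complex.norm_ofNat,
      abs_of_nonneg hw0, show (-w * Complex.I).re = w.im by simp]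
    have hmin : 0 ≤ min (1 / 2) (2 / 3 * δ) := by positivity
    have := pow_le_pow_left₀ hmin h 2
    have := mul_le_mul_of_nonneg_left this (by positivity : 0 ≤ Real.exp w.im / 2)
    linarith
  rcases le_total 0 z.im with h | h
  · exact key z h hz
  · have := key (-z) (by simpa using h) fun k => by
      have := hz (-k - p)
      rwa [← neg_node, ← norm_neg, neg_sub', neg_neg] at this
    simpa using this

lemma cos_eq_nodeSign_iff {p : ℤ} {z : ℂ} : Complex.cos z - nodeSign p = 0 ↔ ∃ k, z = node p k := by
  rw [cos_sub_nodeSign, ← exp_eq_nodeSign_iff]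
  simp [Complex.exp_ne_zero, sub_eq_zero]

lemma analyticOrderAt_cos_sub_nodeSign (p k : ℤ) :
    analyticOrderAt (fun z => Complex.cos z - nodeSign p) (node p k) = 2 := by
  have hfun : (fun z => Complex.cos z - nodeSign p) = (fun z => Complex.exp (-z * Complex.I) / 2) *
      (fun z => Complex.exp (z * Complex.I) - nodeSign p) ^ 2 := by
    ext z; simp [cos_sub_nodeSign]
  have hA : AnalyticAt ℂ (fun z => Complex.exp (z * Complex.I) - nodeSign p) (node p k) := by
    fun_prop
  have hB : AnalyticAt ℂ (fun z => Complex.exp (-z * Complex.I) / 2) (node p k) := by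
    fun_prop
  have hd : HasDerivAt (fun z => Complex.exp (z * Complex.I) - nodeSign p)
      (Complex.exp (node p k * Complex.I) * (1 * Complex.I)) (node p k) :=
    (((hasDerivAt_id _).mul_const Complex.I).cexp).sub_const _
  have h1 : analyticOrderAt (fun z => Complex.exp (z * Complex.I) - nodeSign p) (node p k) = 1 := by
    refine hA.analyticOrderAt_eq_one_of_zero_deriv_ne_zero ?_ ?_
    · exact sub_eq_zero.mpr (exp_eq_nodeSign_iff.mpr ⟨k, rfl⟩)
    · rw [hd.deriv]
      simp [Complex.exp_ne_zero]
  rw [hfun, analyticOrderAt_mul hB (hA.pow 2), analyticOrderAt_pow hA, h1,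
    hB.analyticOrderAt_eq_zero.mpr (by simp [Complex.exp_ne_zero])]
  simp

lemma node_injective (p : ℤ) : Function.Injective (node p) := by
  intro a b h
  have h2 := mul_left_cancel₀ (Complex.ofReal_ne_zero.mpr Real.pi_ne_zero) h
  have h3 : 2 * a + p = 2 * b + p := by exact_mod_cast h2
  omega

lemma hasRootCount_cos_sub_nodeSign_pow (N : ℕ) (p : ℤ) {U : Set ℂ} {F : Finset ℤ}
    (hF : ∀ k, node p k ∈ U ↔ k ∈ F) :
    HasRootCount (fun z => (Complex.cos z - nodeSign p) ^ N) U (2 * N * F.card) := by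
  have hdc : Differentiable ℂ fun z => Complex.cos z - nodeSign p :=
    Complex.differentiable_cos.sub_const _
  have hd : Differentiable ℂ fun z => (Complex.cos z - nodeSign p) ^ N := hdc.pow N
  have hsub : {w ∈ U | (Complex.cos w - nodeSign p) ^ N = 0} ⊆
      (F.map ⟨node p, node_injective p⟩ : Finset ℂ) := by
    rintro w ⟨hw, h0⟩
    obtain ⟨k, rfl⟩ := cos_eq_nodeSign_iff.mp (eq_zero_of_pow_eq_zero h0)
    simpa [hF] using ⟨k, (hF k).mp hw, rfl⟩
  refine ⟨fun z _ => hd.analyticAt z, fun w _ => ?_, (Finset.finite_toSet _).subset hsub, ?_⟩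
  -- All nodes are real, so `I` is a point where the function does not vanish.
  · refine analyticOrderAt_ne_top_of_entire hd (a := Complex.I) ?_ w
    refine pow_ne_zero _ fun h => ?_
    obtain ⟨k, hk⟩ := cos_eq_nodeSign_iff.mp h
    simpa [node] using congrArg Complex.im hk
  · rw [finsum_analyticOrderNatAt_eq_sum hsub (by
      intro x hx
      simp only [Finset.coe_map, Set.mem_image, Finset.mem_coe, Function.Embedding.coeFn_mk] at hx
      obtain ⟨k, hk, rfl⟩ := hx
      exact (hF k).mpr hk), Finset.sum_map]
    have : ∀ k ∈ F, analyticOrderNatAt (fun z => (Complex.cos z - nodeSign p) ^ N) (node p k) =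
        2 * N := by
      intro k _
      have h := analyticOrderAt_pow (hdc.analyticAt (node p k)) (n := N)
      rw [analyticOrderAt_cos_sub_nodeSign] at h
      change analyticOrderAt (fun z => (Complex.cos z - nodeSign p) ^ N) (node p k) = _ at h
      rw [analyticOrderNatAt, h]
      simp [mul_comm]
    simp only [Function.Embedding.coeFn_mk]
    rw [Finset.sum_congr rfl this, Finset.sum_const, smul_eq_mul, mul_comm]

/-- This is the Rouché hypothesis: off the `δ`-discs the model is at least `cᴺ e^{N|Im z|}`, while
the error is at most half of that for large `z`. -/
lemma IsMonodromyZero.exists_norm_sub_lt (hM : IsMonodromyZero M) (p : ℤ) {δ : ℝ} (hδ : 0 < δ) :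
    ∃ R : ℝ, ∀ z : ℂ, R ≤ ‖z‖ → (∀ k, δ ≤ ‖z - node p k‖) →
      ‖Phi M (nodeSign p) z - (Complex.cos z - nodeSign p) ^ N‖ <
        ‖(Complex.cos z - nodeSign p) ^ N‖ := by
  set c := min (1 / 2) (2 / 3 * δ) ^ 2 / 2 with hc
  have hc0 : 0 < c := by positivity
  obtain ⟨R, hR⟩ := hM.Phi_asymp one_pos (by positivity : 0 < c ^ N / 2)
  refine ⟨R, fun z hz hzδ => (hR z _ hz (norm_nodeSign p).le).trans_lt ?_⟩
  have h := pow_le_pow_left₀ (by positivity) (le_norm_cos_sub_nodeSign hδ.le hzδ) N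
  rw [norm_pow]
  refine lt_of_lt_of_le ?_ h
  rw [← hc, mul_pow, ← Real.exp_nat_mul]
  have : 0 < c ^ N := by positivity
  have := Real.exp_pos (N * |z.im|)
  nlinarith

/-! ### Increasing lists of real roots -/

/-- Finitely many real roots can be listed in increasing order, with multiplicity. -/
lemma HasRootCount.exists_monotone {g : ℂ → ℂ} {U : Set ℂ} {n : ℕ} (h : HasRootCount g U n)
    (hreal : ∀ w ∈ U, g w = 0 → w.im = 0) :
    ∃ f : Fin n → ℝ, Monotone f ∧ (∀ i, (f i : ℂ) ∈ U ∧ g (f i) = 0) ∧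
      ∀ w ∈ U, analyticOrderAt g w = {i | (f i : ℂ) = w}.encard := by
  classical
  obtain ⟨-, hfin, hZ, hsum⟩ := h
  set Z := hZ.toFinset with hZdef
  have hmem : ∀ w, w ∈ Z ↔ w ∈ U ∧ g w = 0 := fun w => by simp [hZdef]
  rw [finsum_analyticOrderNatAt_eq_sum (Z := Z) (by simp [hZdef])
    (fun x hx => ((hmem x).mp hx).1)] at hsum
  -- The sigma type repeats each zero according to its order; any enumeration of it is then sorted.
  have hcard : Fintype.card (Σ w : Z, Fin (analyticOrderNatAt g w)) = n := by
    rw [Fintype.card_sigma, ← hsum]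
    simp only [Fintype.card_fin]
    exact Finset.sum_coe_sort Z _
  let e := (Fintype.equivFinOfCardEq hcard).symm
  let f₀ : Fin n → ℝ := fun i => (e i).1.1.re
  have hf₀ : ∀ i, (f₀ i : ℂ) = (e i).1.1 := fun i => by
    have hw := (hmem _).mp (e i).1.2
    exact Complex.ext rfl (by simpa using (hreal _ hw.1 hw.2).symm)
  refine ⟨f₀ ∘ Tuple.sort f₀, Tuple.monotone_sort f₀, fun i => ?_, fun w hw => ?_⟩
  · rw [Function.comp_apply, hf₀]
    exact (hmem _).mp (e _).1.2
  · have h1 : {i | ((f₀ ∘ Tuple.sort f₀) i : ℂ) = w} =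
        ((Finset.univ.filter fun i => ((f₀ ∘ Tuple.sort f₀) i : ℂ) = w : Finset (Fin n)) :
          Set (Fin n)) := by
      ext; simp
    rw [h1, Set.encard_coe_eq_coe_finsetCard, ← Nat.cast_analyticOrderNatAt (hfin w hw),
      Finset.card_filter]
    congr 1
    simp only [Function.comp_apply, hf₀]
    rw [Equiv.sum_comp (Tuple.sort f₀) (fun i => if ((e i).1.1 : ℂ) = w then 1 else 0),
      Equiv.sum_comp e (fun t => if (t.1.1 : ℂ) = w then 1 else 0), Fintype.sum_sigma]
    have hinner : ∀ x : Z, (∑ i : Fin (analyticOrderNatAt g x),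
        if ((⟨x, i⟩ : Σ w : Z, Fin (analyticOrderNatAt g w)).1.1 : ℂ) = w then 1 else 0) =
          if (x : ℂ) = w then analyticOrderNatAt g x else 0 := fun x => by
      by_cases hx : (x : ℂ) = w <;> simp [hx]
    rw [Finset.sum_congr rfl fun x _ => hinner x,
      Finset.sum_coe_sort Z (fun x => if x = w then analyticOrderNatAt g x else 0),
      Finset.sum_ite_eq']
    split_ifs with hwZ
    · rfl
    · have : g w ≠ 0 := fun h0 => hwZ ((hmem w).mpr ⟨hw, h0⟩)
      rw [analyticOrderNatAt, analyticOrderAt_eq_zero.mpr (Or.inr this)]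
      rfl

lemma node_eq_ofReal (p k : ℤ) : node p k = ((Real.pi * (2 * k + p : ℤ) : ℝ) : ℂ) := by
  simp [node]

lemma ofReal_mem_ball_iff {x c r : ℝ} : (x : ℂ) ∈ Metric.ball (c : ℂ) r ↔ |x - c| < r := by
  rw [Metric.mem_ball, Complex.dist_eq, ← Complex.ofReal_sub, Complex.norm_real, Real.norm_eq_abs]

lemma ofReal_mem_ball_zero_iff {x r : ℝ} : (x : ℂ) ∈ Metric.ball (0 : ℂ) r ↔ |x| < r := by
  simp

lemma ofReal_mem_ball_node_iff {x r : ℝ} {p k : ℤ} :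
    (x : ℂ) ∈ Metric.ball (node p k) r ↔ |x - Real.pi * (2 * k + p : ℤ)| < r := by
  rw [node_eq_ofReal, ofReal_mem_ball_iff]

/-- The roots of `g` are distributed as those of `(cos z - cos (π p)) ^ m`, up to finitely many
roots in a central disc of radius `π K`. -/
structure HasNodalRoots (g : ℂ → ℂ) (p a : ℤ) (K m : ℕ) : Prop where
  radius : (K : ℤ) = 1 - p - 2 * a
  center : HasRootCount g (Metric.ball 0 (Real.pi * K)) (K * m)
  outer : ∀ k, k < a ∨ a + K ≤ k → HasRootCount g (Metric.ball (node p k) (Real.pi / 2)) m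
  exhaust : ∀ z, g z = 0 → z ∈ Metric.ball (0 : ℂ) (Real.pi * K) ∨
    ∃ k, (k < a ∨ a + K ≤ k) ∧ z ∈ Metric.ball (node p k) (Real.pi / 2)

/-- Two distinct nodal discs of radius `π / 2` are disjoint. -/
lemma eq_of_abs_sub_lt {p k l : ℤ} {x : ℝ} (hk : |x - Real.pi * (2 * k + p : ℤ)| < Real.pi / 2)
    (hl : |x - Real.pi * (2 * l + p : ℤ)| < Real.pi / 2) : k = l := by
  have hπ := Real.pi_pos
  rw [abs_lt] at hk hl
  push_cast at hk hl
  by_contra hne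
  rcases lt_or_gt_of_ne hne with h | h
  · have : (k : ℝ) + 1 ≤ l := by exact_mod_cast h
    nlinarith
  · have : (l : ℝ) + 1 ≤ k := by exact_mod_cast h
    nlinarith

lemma pi_mul_lt_of_abs_sub_lt {K p k : ℤ} {x : ℝ}
    (hk : |x - Real.pi * (2 * k + p : ℤ)| < Real.pi / 2) (h : K < 2 * k + p) :
    Real.pi * K < x := by
  have hπ := Real.pi_pos
  rw [abs_lt] at hk
  have : (K : ℝ) + 1 ≤ (2 * k + p : ℤ) := by exact_mod_cast h
  nlinarith

lemma lt_pi_mul_of_abs_sub_lt {K p k : ℤ} {x : ℝ}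
    (hk : |x - Real.pi * (2 * k + p : ℤ)| < Real.pi / 2) (h : 2 * k + p < K) :
    x < Real.pi * K := by
  have hπ := Real.pi_pos
  rw [abs_lt] at hk
  have : ((2 * k + p : ℤ) : ℝ) + 1 ≤ K := by exact_mod_cast h
  nlinarith

/-- Nodally distributed real roots can be listed by `ℤ × Fin N`, increasingly. -/
lemma HasNodalRoots.exists_labels {g : ℂ → ℂ} {p a : ℤ} {K : ℕ} (h : HasNodalRoots g p a K N)
    (hreal : ∀ w, g w = 0 → w.im = 0) :
    ∃ y : ℤ → Fin N → ℝ, (∀ k, Monotone (y k)) ∧ (∀ k i j, y k i ≤ y (k + 1) j) ∧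
      (∀ w : ℂ, analyticOrderAt g w = {q : ℤ × Fin N | (y q.1 q.2 : ℂ) = w}.encard) ∧
      (∀ k j, g (y k j) = 0) ∧
      ∀ k, k < a ∨ a + K ≤ k → ∀ j, |y k j - Real.pi * (2 * k + p : ℤ)| < Real.pi / 2 := by
  obtain ⟨hK, h0, h1, hex⟩ := h
  obtain ⟨f, hfm, hfz, hfo⟩ := h0.exists_monotone fun w _ => hreal w
  choose u hum huz huo using fun k hk => (h1 k hk).exists_monotone fun w _ => hreal w
  have hnot : ∀ {k : ℤ}, ¬(a ≤ k ∧ k < a + K) → k < a ∨ a + K ≤ k := by intro k hk; omega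
  have hlt : ∀ {k : ℤ}, a ≤ k ∧ k < a + K → (k - a).toNat < K := by intro k hk; omega
  -- `finProdFinEquiv` sends `(i, j)` to `j + N * i`, so the sorted central list is cut into `K`
  -- consecutive blocks of length `N`.
  set y : ℤ → Fin N → ℝ := fun k => if hk : a ≤ k ∧ k < a + K then
    fun j => f (finProdFinEquiv (⟨(k - a).toNat, hlt hk⟩, j)) else u k (hnot hk) with hy
  have ymid : ∀ {k : ℤ} (hk : a ≤ k ∧ k < a + K),
      y k = fun j => f (finProdFinEquiv (⟨(k - a).toNat, hlt hk⟩, j)) := fun hk => by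
    simp only [hy, dif_pos hk]
  have yout : ∀ {k : ℤ} (hk : k < a ∨ a + K ≤ k), y k = u k hk := fun {k} hk => by
    have : ¬(a ≤ k ∧ k < a + K) := by omega
    simp only [hy, dif_neg this]
  have hmid : ∀ {k : ℤ}, a ≤ k ∧ k < a + K → ∀ j, |y k j| < Real.pi * K := fun hk j => by
    rw [ymid hk]
    exact ofReal_mem_ball_zero_iff.mp (hfz _).1
  have hout : ∀ {k : ℤ}, k < a ∨ a + K ≤ k → ∀ j,
      |y k j - Real.pi * (2 * k + p : ℤ)| < Real.pi / 2 := fun hk j => by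
    rw [yout hk]
    exact ofReal_mem_ball_node_iff.mp (huz _ hk j).1
  have hright : ∀ {k : ℤ}, a + K ≤ k → ∀ j, Real.pi * K < y k j := fun {k} hk j => by
    have := pi_mul_lt_of_abs_sub_lt (K := K) (hout (Or.inr hk) j) (by omega)
    exact_mod_cast this
  have hleft : ∀ {k : ℤ}, k < a → ∀ j, y k j < -(Real.pi * K) := fun {k} hk j => by
    have := lt_pi_mul_of_abs_sub_lt (K := -K) (hout (Or.inl hk) j) (by omega)
    push_cast at this
    linarith
  have hzero : ∀ k j, g (y k j) = 0 := by
    intro k j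
    by_cases hk : a ≤ k ∧ k < a + K
    · rw [ymid hk]; exact (hfz _).2
    · rw [yout (hnot hk)]; exact (huz k _ j).2
  refine ⟨y, fun k => ?_, fun k i j => ?_, fun w => ?_, hzero, fun k hk j => hout hk j⟩
  · by_cases hk : a ≤ k ∧ k < a + K
    · rw [ymid hk]
      intro i j hij
      apply hfm
      rw [Fin.le_def] at hij ⊢
      simpa using hij
    · rw [yout (hnot hk)]
      exact hum k _
  · by_cases hk : a ≤ k ∧ k < a + K
    · by_cases hk' : a ≤ k + 1 ∧ k + 1 < a + K
      · rw [ymid hk, ymid hk']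
        apply hfm
        rw [Fin.le_def]
        simp only [finProdFinEquiv_apply_val]
        have : (k + 1 - a).toNat = (k - a).toNat + 1 := by omega
        rw [this, mul_add]
        have := i.2
        omega
      · exact ((abs_lt.mp (hmid hk i)).2.trans (hright (by omega) j)).le
    · by_cases hk' : a ≤ k + 1 ∧ k + 1 < a + K
      · exact ((hleft (by omega) i).trans (abs_lt.mp (hmid hk' j)).1).le
      · have h1 := abs_lt.mp (hout (hnot hk) i)
        have h2 := abs_lt.mp (hout (hnot hk') j)
        have hπ := Real.pi_pos
        push_cast at h1 h2
        nlinarith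
  · by_cases hw0 : g w = 0
    · rcases hex w hw0 with hw | ⟨k, hk, hw⟩
      · have hset : {q : ℤ × Fin N | (y q.1 q.2 : ℂ) = w} =
            (fun i : Fin (K * N) => (a + ((finProdFinEquiv.symm i).1 : ℕ),
              (finProdFinEquiv.symm i).2)) '' {i | (f i : ℂ) = w} := by
          ext ⟨l, j⟩
          simp only [Set.mem_ofPred_eq, Set.mem_image, Prod.mk.injEq]
          constructor
          · intro hl
            by_cases hlm : a ≤ l ∧ l < a + K
            · rw [ymid hlm] at hl
              refine ⟨_, hl, ?_⟩
              simp only [Equiv.symm_apply_apply, and_true]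
              omega
            · exfalso
              rw [← hl, ofReal_mem_ball_zero_iff, abs_lt] at hw
              rcases hnot hlm with hl' | hl'
              · exact (hw.1.trans (hleft hl' j)).false
              · exact (hw.2.trans (hright hl' j)).false
          · rintro ⟨i, hi, rfl, rfl⟩
            have hlm : a ≤ a + ((finProdFinEquiv.symm i).1 : ℕ) ∧
                a + ((finProdFinEquiv.symm i).1 : ℕ) < a + K := by
              have := (finProdFinEquiv.symm i).1.2
              omega
            rw [ymid hlm, ← hi]
            refine congrArg (fun m => ((f m : ℝ) : ℂ)) ?_
            rw [← Equiv.eq_symm_apply]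
            refine Prod.ext (Fin.ext ?_) rfl
            dsimp only
            omega
        rw [hset, hfo w hw, Function.Injective.encard_image]
        intro i i' hii
        apply finProdFinEquiv.symm.injective
        simp only [Prod.mk.injEq] at hii
        refine Prod.ext (Fin.ext ?_) hii.2
        have := hii.1
        omega
      · have hset : {q : ℤ × Fin N | (y q.1 q.2 : ℂ) = w} =
            (fun j => (k, j)) '' {j | (u k hk j : ℂ) = w} := by
          ext ⟨l, j⟩
          simp only [Set.mem_ofPred_eq, Set.mem_image, Prod.mk.injEq]
          constructor
          · intro hl
            have hlk : k = l := by
              rw [← hl, ofReal_mem_ball_node_iff] at hw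
              by_cases hlm : a ≤ l ∧ l < a + K
              · exfalso
                have h3 := abs_lt.mp (hmid hlm j)
                rcases hk with hk | hk
                · have := lt_pi_mul_of_abs_sub_lt (K := -K) hw (by omega)
                  push_cast at this
                  linarith
                · have := pi_mul_lt_of_abs_sub_lt (K := K) hw (by omega)
                  push_cast at this
                  linarith
              · exact eq_of_abs_sub_lt hw (hout (hnot hlm) j)
            subst hlk
            rw [yout hk] at hl
            exact ⟨j, hl, rfl, rfl⟩
          · rintro ⟨i, hi, rfl, rfl⟩
            rw [yout hk, hi]
        rw [hset, huo k hk w hw, Function.Injective.encard_image]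
        intro i i' hii
        exact (Prod.mk.injEq _ _ _ _ ▸ hii).2
    · rw [analyticOrderAt_eq_zero.mpr (Or.inr hw0), eq_comm, Set.encard_eq_zero,
        Set.eq_empty_iff_forall_notMem]
      rintro ⟨k, j⟩ hkj
      exact hw0 (hkj ▸ hzero k j)

/-! ### Root counts and asymptotics via comparison with the nodes -/

lemma norm_node (p k : ℤ) : ‖node p k‖ = Real.pi * |((2 * k + p : ℤ) : ℝ)| := by
  rw [node_eq_ofReal, Complex.norm_real, Real.norm_eq_abs, abs_mul, abs_of_pos Real.pi_pos]

lemma dist_node (p k l : ℤ) : dist (node p k) (node p l) = Real.pi * (2 * |((k - l : ℤ) : ℝ)|) := by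
  rw [node_eq_ofReal, node_eq_ofReal, Complex.dist_eq, ← Complex.ofReal_sub, Complex.norm_real,
    Real.norm_eq_abs, ← mul_sub, abs_mul, abs_of_pos Real.pi_pos]
  congr 1
  rw [show ((2 * k + p : ℤ) : ℝ) - (2 * l + p : ℤ) = 2 * (k - l : ℤ) by push_cast; ring, abs_mul,
    abs_two]

lemma two_pi_le_dist_node {p k l : ℤ} (h : k ≠ l) : 2 * Real.pi ≤ dist (node p k) (node p l) := by
  rw [dist_node]
  have h1 : (1 : ℝ) ≤ |((k - l : ℤ) : ℝ)| := by
    exact_mod_cast Int.one_le_abs (sub_ne_zero.mpr h)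
  nlinarith [Real.pi_pos]

/-- The roots of `Φ(± 1, ·)` far from the origin lie near the nodes. -/
lemma IsMonodromyZero.exists_node_near (hM : IsMonodromyZero M) (p : ℤ) {δ : ℝ} (hδ : 0 < δ) :
    ∃ R : ℝ, ∀ z : ℂ, R ≤ ‖z‖ → Phi M (nodeSign p) z = 0 → ∃ k, ‖z - node p k‖ < δ := by
  obtain ⟨R, hR⟩ := hM.exists_norm_sub_lt p hδ
  refine ⟨R, fun z hz h0 => ?_⟩
  by_contra! h
  have := hR z hz h
  rw [h0, zero_sub, norm_neg] at this
  exact this.false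

/-- The relation between `K`, `p` and `a` makes `2k + p` run from `1 - K` to `K - 1` for `a ≤ k < a
+ K`. Hence the central disc contains exactly these `K` nodes, and its boundary is at distance at
least `π` from every node. -/
lemma IsMonodromyZero.exists_hasNodalRoots_Phi (hM : IsMonodromyZero M) (p : ℤ) :
    ∃ K₀ : ℝ, ∀ (K : ℕ) (a : ℤ), K₀ ≤ K → (K : ℤ) = 1 - p - 2 * a →
      HasNodalRoots (Phi M (nodeSign p)) p a K (2 * N) := by
  have hπ := Real.pi_pos
  obtain ⟨R, hR⟩ := hM.exists_norm_sub_lt p (half_pos hπ)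
  refine ⟨max R 1, fun K a hK₀ hK => ?_⟩
  obtain ⟨hRK, hK1⟩ := max_le_iff.mp hK₀
  have hπ3 := Real.pi_gt_three
  have hdΦ := hM.differentiable_Phi (nodeSign p)
  have hdc : Differentiable ℂ fun z => (Complex.cos z - nodeSign p) ^ N :=
    (Complex.differentiable_cos.sub_const _).pow N
  have hnorm : ∀ k, k < a ∨ a + K ≤ k → Real.pi * (K + 1) ≤ ‖node p k‖ := fun k hk => by
    rw [norm_node]
    have h1 : (K : ℤ) + 1 ≤ |2 * k + p| := by
      rw [le_abs]
      omega
    have h2 : (K : ℝ) + 1 ≤ |((2 * k + p : ℤ) : ℝ)| := by exact_mod_cast h1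
    gcongr
  have hball : ∀ k, node p k ∈ Metric.ball (0 : ℂ) (Real.pi * K) ↔ k ∈ Finset.Ico a (a + K) := by
    intro k
    rw [mem_ball_zero_iff, norm_node, mul_lt_mul_iff_right₀ hπ, Finset.mem_Ico]
    have : |((2 * k + p : ℤ) : ℝ)| < K ↔ |2 * k + p| < (K : ℤ) := by
      rw [← Int.cast_abs, ← Int.cast_natCast, Int.cast_lt]
    rw [this, abs_lt]
    omega
  refine ⟨hK, ?_, fun k hk => ?_, fun z hz => ?_⟩
  · have h := hasRootCount_cos_sub_nodeSign_pow N p hball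
    rw [Int.card_Ico, add_sub_cancel_left, Int.toNat_natCast, mul_comm (2 * N)] at h
    refine h.of_norm_sub_lt hdΦ hdc (by positivity) fun z hz => hR z ?_ fun k => ?_
    · rw [mem_sphere_zero_iff_norm] at hz
      rw [hz]
      nlinarith
    · rw [mem_sphere_zero_iff_norm] at hz
      -- `K` and `2k + p` have opposite parity, so they cannot agree in absolute value.
      have h1 : (1 : ℝ) ≤ abs ((K : ℝ) - abs ((2 * k + p : ℤ) : ℝ)) := by
        have : (1 : ℤ) ≤ abs ((K : ℤ) - abs (2 * k + p)) := by
          apply Int.one_le_abs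
          rcases abs_choice (2 * k + p) with h | h <;> rw [h] <;> omega
        exact_mod_cast this
      have h2 := abs_norm_sub_norm_le z (node p k)
      rw [hz, norm_node, ← mul_sub, abs_mul, abs_of_pos hπ] at h2
      nlinarith
  · have hF : ∀ l, node p l ∈ Metric.ball (node p k) (Real.pi / 2) ↔ l ∈ ({k} : Finset ℤ) := by
      intro l
      rw [Finset.mem_singleton]
      constructor
      · intro h
        by_contra hne
        have := two_pi_le_dist_node (p := p) hne
        rw [Metric.mem_ball] at h
        linarith
      · rintro rfl
        exact Metric.mem_ball_self (half_pos hπ)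
    have h := hasRootCount_cos_sub_nodeSign_pow N p hF
    rw [Finset.card_singleton, mul_one] at h
    refine h.of_norm_sub_lt hdΦ hdc (half_pos hπ) fun z hz => hR z ?_ fun l => ?_
    · have h1 := hnorm k hk
      have h2 := norm_sub_norm_le (node p k) z
      rw [Metric.mem_sphere, dist_comm, dist_eq_norm] at hz
      nlinarith
    · rw [Metric.mem_sphere] at hz
      rw [← dist_eq_norm]
      by_cases hlk : l = k
      · rw [hlk, hz]
      · have h1 := two_pi_le_dist_node (p := p) hlk
        have h2 := dist_triangle_left (node p l) (node p k) z
        linarith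
  -- Outside every disc of the list, `z` is at least `π/2` from all nodes, the central ones having
  -- modulus at most `π(K - 1)`; the strict Rouché inequality then excludes a zero.
  · by_contra! hcon
    obtain ⟨hz1, hz2⟩ := hcon
    rw [mem_ball_zero_iff, not_lt] at hz1
    have := hR z (by nlinarith) fun k => by
      by_contra! hlt
      by_cases hk : k < a ∨ a + K ≤ k
      · exact hz2 k hk (by rwa [Metric.mem_ball, dist_eq_norm])
      · have h3 : ‖node p k‖ ≤ Real.pi * (K - 1) := by
          rw [norm_node]
          have h1 : |2 * k + p| ≤ (K : ℤ) - 1 := by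
            rw [abs_le]
            omega
          have h2 : |((2 * k + p : ℤ) : ℝ)| ≤ (K : ℝ) - 1 := by exact_mod_cast h1
          gcongr
        have h2 := norm_sub_norm_le z (node p k)
        nlinarith
    rw [hz, zero_sub, norm_neg] at this
    exact this.false

lemma HasNodalRoots.D_of_Phi (hM : IsMonodromy M) {p a : ℤ} {K : ℕ}
    (h : HasNodalRoots (Phi M (nodeSign p)) p a K (2 * N)) :
    HasNodalRoots (D M (nodeSign p)) p a K N := by
  have hσ := nodeSign_mul_self p
  refine ⟨h.radius, hM.hasRootCount_D hσ ?_, fun k hk => hM.hasRootCount_D hσ (h.outer k hk),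
    fun z hz => h.exhaust z ((hM.Phi_eq_zero_iff hσ).mpr hz)⟩
  have := h.center
  rwa [mul_left_comm] at this

/-- The eigenvalues of one parity can be labeled increasingly and are asymptotic to the nodes. -/
lemma IsMonodromyZero.exists_labels (hM : IsMonodromyZero M) {p a : ℤ} {K : ℕ}
    (h : HasNodalRoots (D M (nodeSign p)) p a K N) :
    ∃ y : ℤ → Fin N → ℝ, (∀ k, Monotone (y k)) ∧ (∀ k i j, y k i ≤ y (k + 1) j) ∧
      (∀ w : ℂ, analyticOrderAt (D M (nodeSign p)) w =
        {q : ℤ × Fin N | (y q.1 q.2 : ℂ) = w}.encard) ∧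
      ∀ ε > (0 : ℝ), ∃ B : ℤ, ∀ k, B ≤ |2 * k + p| →
        ∀ j, |y k j - Real.pi * (2 * k + p : ℤ)| < ε := by
  have hπ := Real.pi_pos
  obtain ⟨y, hmono, hnext, hord, hzero, hout⟩ := h.exists_labels
    fun w => hM.im_eq_zero_of_D_eq_zero (norm_nodeSign p)
  refine ⟨y, hmono, hnext, hord, fun ε hε => ?_⟩
  -- The cap `π/2` forces the nearby node to be the one whose disc already contains `y k j`.
  obtain ⟨R, hR⟩ := hM.exists_node_near p (lt_min hε (half_pos hπ))
  have hK := h.radius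
  -- The first bound makes `k` an outer index; the second gives `|y k j| ≥ R`.
  refine ⟨max (K + 1) (⌈R⌉ + 1), fun k hk j => ?_⟩
  obtain ⟨hk1, hk2⟩ := max_le_iff.mp hk
  have hk3 : k < a ∨ a + K ≤ k := by
    rw [le_abs] at hk1
    omega
  have hnear := hout k hk3 j
  have hR1 : R + 1 ≤ |((2 * k + p : ℤ) : ℝ)| := by
    have : ((⌈R⌉ : ℤ) : ℝ) + 1 ≤ |((2 * k + p : ℤ) : ℝ)| := by exact_mod_cast hk2
    linarith [Int.le_ceil R]
  have hK1 : (1 : ℝ) ≤ |((2 * k + p : ℤ) : ℝ)| := by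
    have : (1 : ℤ) ≤ |2 * k + p| := by omega
    exact_mod_cast this
  have hyR : R ≤ ‖((y k j : ℝ) : ℂ)‖ := by
    rw [Complex.norm_real, Real.norm_eq_abs]
    have h1 := abs_sub_abs_le_abs_sub (Real.pi * (2 * k + p : ℤ)) (y k j)
    rw [abs_sub_comm, abs_mul, abs_of_pos hπ] at h1
    nlinarith [Real.pi_gt_three, Real.pi_lt_four]
  obtain ⟨l, hl⟩ := hR _ hyR ((hM.Phi_eq_zero_iff (nodeSign_mul_self p)).mpr (hzero k j))
  rw [← dist_eq_norm, ← Metric.mem_ball, ofReal_mem_ball_node_iff, lt_min_iff] at hl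
  rw [eq_of_abs_sub_lt hnear hl.2]
  rw [eq_of_abs_sub_lt hnear hl.2] at hl
  exact hl.1

/-! ### Merging the two parities -/

lemma tendsto_of_forall_abs_lt {u : ℤ → ℝ} (h : ∀ ε > (0 : ℝ), ∃ B : ℤ, ∀ n, B ≤ |n| → |u n| < ε) :
    Tendsto u atTop (𝓝 0) ∧ Tendsto u atBot (𝓝 0) := by
  simp only [Metric.tendsto_nhds, Real.dist_eq, sub_zero]
  constructor <;> intro ε hε <;> obtain ⟨B, hB⟩ := h ε hε
  · filter_upwards [eventually_ge_atTop B] with n hn using hB n (hn.trans (le_abs_self n))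
  · filter_upwards [eventually_le_atBot (-B)] with n hn
    exact hB n (by rw [le_abs]; omega)

lemma encard_parity_labels {z y : ℤ → Fin N → ℝ} {p : ℤ} {P : ℤ → Prop}
    (hP : ∀ n, P n ↔ ∃ k, n = 2 * k + p) (hz : ∀ k, z (2 * k + p) = y k) (w : ℂ) :
    {q : ℤ × Fin N | P q.1 ∧ (z q.1 q.2 : ℂ) = w}.encard =
      {q : ℤ × Fin N | (y q.1 q.2 : ℂ) = w}.encard := by
  have : {q : ℤ × Fin N | P q.1 ∧ (z q.1 q.2 : ℂ) = w} =
      (fun q : ℤ × Fin N => (2 * q.1 + p, q.2)) '' {q : ℤ × Fin N | (y q.1 q.2 : ℂ) = w} := by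
    ext ⟨n, j⟩
    simp only [Set.mem_ofPred_eq, Set.mem_image, Prod.mk.injEq, Prod.exists, hP]
    constructor
    · rintro ⟨⟨k, rfl⟩, hw⟩
      exact ⟨k, j, by rwa [← hz], rfl, rfl⟩
    · rintro ⟨k, i, hw, rfl, rfl⟩
      exact ⟨⟨k, rfl⟩, by rwa [hz]⟩
  rw [this, Function.Injective.encard_image]
  rintro ⟨k, i⟩ ⟨l, j⟩ h
  simp only [Prod.mk.injEq] at h ⊢
  exact ⟨by omega, h.2⟩

end MonodromyMatrix

open MonodromyMatrix in
theorem lemma2p2 (N : ℕ) (hN : 2 ≤ N) (M : ℂ → Matrix (Fin N) (Fin N) ℂ)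
    (hM : IsMonodromyZero M) :
    -- asymptotics of `Φ`, uniform in bounded `ν`
    (∀ A > (0 : ℝ), ∀ ε > (0 : ℝ), ∃ R : ℝ, ∀ z ν : ℂ, R ≤ ‖z‖ → ‖ν‖ ≤ A →
      ‖Phi M ν z - (Complex.cos z - ν) ^ N‖ ≤ ε * Real.exp (N * |z.im|)) ∧
    (∃ n₀ : ℕ,
      -- roots of `Φ(1, ·)`, and of `D(1, ·)`
      (HasRootCount (Phi M 1) (Metric.ball 0 (Real.pi * (2 * n₀ + 1))) (2 * N * (2 * n₀ + 1)) ∧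
        HasRootCount (D M 1) (Metric.ball 0 (Real.pi * (2 * n₀ + 1))) (N * (2 * n₀ + 1)) ∧
        (∀ n : ℤ, (n₀ : ℤ) < |n| →
          HasRootCount (Phi M 1) (Metric.ball (2 * Real.pi * n : ℂ) (Real.pi / 2)) (2 * N) ∧
          HasRootCount (D M 1) (Metric.ball (2 * Real.pi * n : ℂ) (Real.pi / 2)) N) ∧
        (∀ z : ℂ, Phi M 1 z = 0 ∨ D M 1 z = 0 →
          z ∈ Metric.ball (0 : ℂ) (Real.pi * (2 * n₀ + 1)) ∨
          ∃ n : ℤ, (n₀ : ℤ) < |n| ∧ z ∈ Metric.ball (2 * Real.pi * n : ℂ) (Real.pi / 2))) ∧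
      -- roots of `Φ(-1, ·)`, and of `D(-1, ·)`
      (HasRootCount (Phi M (-1)) (Metric.ball 0 (2 * Real.pi * n₀)) (4 * N * n₀) ∧
        HasRootCount (D M (-1)) (Metric.ball 0 (2 * Real.pi * n₀)) (2 * N * n₀) ∧
        (∀ n : ℤ, 2 * (n₀ : ℤ) < |2 * n + 1| →
          HasRootCount (Phi M (-1)) (Metric.ball (Real.pi * (2 * n + 1) : ℂ) (Real.pi / 2))
            (2 * N) ∧
          HasRootCount (D M (-1)) (Metric.ball (Real.pi * (2 * n + 1) : ℂ) (Real.pi / 2)) N) ∧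
        (∀ z : ℂ, Phi M (-1) z = 0 ∨ D M (-1) z = 0 →
          z ∈ Metric.ball (0 : ℂ) (2 * Real.pi * n₀) ∨
          ∃ n : ℤ, 2 * (n₀ : ℤ) < |2 * n + 1| ∧
            z ∈ Metric.ball (Real.pi * (2 * n + 1) : ℂ) (Real.pi / 2)))) ∧
    -- periodic and antiperiodic eigenvalues are real
    (∀ z : ℂ, D M 1 z = 0 ∨ D M (-1) z = 0 → z.im = 0) ∧
    -- their labeling and asymptotics
    (∃ z : ℤ → Fin N → ℝ, IsEigenvalueLabeling M z ∧
      ∀ j, Tendsto (fun n : ℤ => z n j - Real.pi * n) atTop (𝓝 0) ∧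
        Tendsto (fun n : ℤ => z n j - Real.pi * n) atBot (𝓝 0)) := by
  obtain ⟨K₀, h₀⟩ := hM.exists_hasNodalRoots_Phi 0
  obtain ⟨K₁, h₁⟩ := hM.exists_hasNodalRoots_Phi 1
  obtain ⟨n₀, hn₀⟩ := exists_nat_ge (max K₀ K₁)
  obtain ⟨hK₀, hK₁⟩ := max_le_iff.mp hn₀
  have hn₀' : (0 : ℝ) ≤ n₀ := n₀.cast_nonneg
  -- Starting at `a = -n₀` for both parities, the radius relation forces `K = 2n₀ + 1` when `p = 0`
  -- and `K = 2n₀` when `p = 1`.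
  have e₀ := h₀ (2 * n₀ + 1) (-n₀) (by push_cast; linarith) (by push_cast; ring)
  have e₁ := h₁ (2 * n₀) (-n₀) (by push_cast; linarith) (by push_cast; ring)
  have d₀ := e₀.D_of_Phi hM.toIsMonodromy
  have d₁ := e₁.D_of_Phi hM.toIsMonodromy
  obtain ⟨y₀, mono₀, next₀, ord₀, asymp₀⟩ := hM.exists_labels d₀
  obtain ⟨y₁, mono₁, next₁, ord₁, asymp₁⟩ := hM.exists_labels d₁
  have hPhi : ∀ {p : ℤ} {z : ℂ}, Phi M (nodeSign p) z = 0 ∨ D M (nodeSign p) z = 0 →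
      Phi M (nodeSign p) z = 0 := fun h =>
    h.elim id (hM.Phi_eq_zero_iff (nodeSign_mul_self _)).mpr
  rw [nodeSign_zero] at e₀ d₀ ord₀
  rw [nodeSign_one] at e₁ d₁ ord₁
  have hnode₀ : ∀ n : ℤ, node 0 n = 2 * Real.pi * n := fun n => by
    rw [node]; push_cast; ring
  have hnode₁ : ∀ n : ℤ, node 1 n = Real.pi * (2 * n + 1) := fun n => by
    rw [node]; push_cast; ring
  have hrad₀ : Real.pi * ((2 * n₀ + 1 : ℕ) : ℝ) = Real.pi * (2 * n₀ + 1) := by push_cast; ring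
  have hrad₁ : Real.pi * ((2 * n₀ : ℕ) : ℝ) = 2 * Real.pi * n₀ := by push_cast; ring
  have hout₀ : ∀ n : ℤ, (n₀ : ℤ) < |n| ↔ n < -n₀ ∨ -n₀ + ((2 * n₀ + 1 : ℕ) : ℤ) ≤ n := fun n => by
    rw [lt_abs]; omega
  have hout₁ : ∀ n : ℤ, 2 * (n₀ : ℤ) < |2 * n + 1| ↔ n < -n₀ ∨ -n₀ + ((2 * n₀ : ℕ) : ℤ) ≤ n :=
    fun n => by rw [lt_abs]; omega
  refine ⟨fun A hA ε hε => hM.Phi_asymp hA hε, ⟨n₀, ⟨?_, ?_, fun n hn => ?_, fun z hz => ?_⟩,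
    ?_, ?_, fun n hn => ?_, fun z hz => ?_⟩, fun z hz => ?_, ?_⟩
  · have := e₀.center
    rwa [hrad₀, mul_comm (2 * n₀ + 1)] at this
  · have := d₀.center
    rwa [hrad₀, mul_comm (2 * n₀ + 1)] at this
  · rw [← hnode₀]
    exact ⟨e₀.outer n ((hout₀ n).mp hn), d₀.outer n ((hout₀ n).mp hn)⟩
  · have := e₀.exhaust z (by simpa only [nodeSign_zero] using hPhi (p := 0) (by rwa [nodeSign_zero]))
    simpa only [hrad₀, hout₀, hnode₀] using this
  · have := e₁.center
    rwa [hrad₁, show 2 * n₀ * (2 * N) = 4 * N * n₀ by ring] at this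
  · have := d₁.center
    rwa [hrad₁, show 2 * n₀ * N = 2 * N * n₀ by ring] at this
  · rw [← hnode₁]
    exact ⟨e₁.outer n ((hout₁ n).mp hn), d₁.outer n ((hout₁ n).mp hn)⟩
  · have := e₁.exhaust z (by simpa only [nodeSign_one] using hPhi (p := 1) (by rwa [nodeSign_one]))
    simpa only [hrad₁, hout₁, hnode₁] using this
  · rcases hz with hz | hz
    · exact hM.im_eq_zero_of_D_eq_zero (by simp) hz
    · exact hM.im_eq_zero_of_D_eq_zero (by simp) hz
  -- Integer division rounds down here, so `2k` and `2k + 1` both give `k`, also for negative `k`.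
  · set z : ℤ → Fin N → ℝ := fun n => if Even n then y₀ (n / 2) else y₁ (n / 2) with hz
    have hz₀ : ∀ k, z (2 * k + 0) = y₀ k := fun k => by
      have : Even (2 * k + 0) := by simp
      simp only [hz, if_pos this]
      congr 1
      omega
    have hz₁ : ∀ k, z (2 * k + 1) = y₁ k := fun k => by
      have : ¬Even (2 * k + 1) := by simp
      simp only [hz, if_neg this]
      congr 1
      omega
    have hpar : ∀ n : ℤ, (∃ k, n = 2 * k + 0) ∨ ∃ k, n = 2 * k + 1 := fun n => by
      rcases Int.even_or_odd' n with ⟨k, hk | hk⟩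
      · exact Or.inl ⟨k, by omega⟩
      · exact Or.inr ⟨k, hk⟩
    refine ⟨z, ⟨fun n => ?_, fun n i j => ?_, fun w => ?_, fun w => ?_⟩, fun j => ?_⟩
    · rcases hpar n with ⟨k, rfl⟩ | ⟨k, rfl⟩
      · rw [hz₀]; exact mono₀ k
      · rw [hz₁]; exact mono₁ k
    · rcases hpar n with ⟨k, rfl⟩ | ⟨k, rfl⟩
      · rw [show 2 * k + 0 + 2 = 2 * (k + 1) + 0 by ring, hz₀, hz₀]; exact next₀ k i j
      · rw [show 2 * k + 1 + 2 = 2 * (k + 1) + 1 by ring, hz₁, hz₁]; exact next₁ k i j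
    · rw [ord₀, encard_parity_labels (fun n => by simp [even_iff_exists_two_mul]) hz₀]
    · rw [ord₁, encard_parity_labels (P := Odd) (fun n => Iff.rfl) hz₁]
    · refine tendsto_of_forall_abs_lt fun ε hε => ?_
      obtain ⟨B₀, hB₀⟩ := asymp₀ ε hε
      obtain ⟨B₁, hB₁⟩ := asymp₁ ε hε
      refine ⟨max B₀ B₁, fun n hn => ?_⟩
      obtain ⟨hn₀, hn₁⟩ := max_le_iff.mp hn
      rcases hpar n with ⟨k, rfl⟩ | ⟨k, rfl⟩
      · rw [hz₀]; exact hB₀ k hn₀ j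
      · rw [hz₁]; exact hB₁ k hn₁ j
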